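/- Let $n\ge 1$. A permutation $\pi=a_1a_2\cdots a_{2n}$ of $\{1,\dots,2n\}$ has a descent at $i$ ($1\le i\le 2n-1$) if $a_i>a_{i+1}$; let $d(\pi)$ be its number of descents, let $\mathcal J_{2n}$ be the set of fixed-point free involutions of $\{1,\dots,2n\}$, and put $$J_{2n}(t)=\sum_{\pi\in\mathcal J_{2n}}t^{d(\pi)}=\sum_{k}J_{2n,k}\,t^k .$$ For an integer $k$ define $b_{2n,k}$ by $$b_{2n,k}=\begin{cases}\displaystyle\sum_{j=1}^{k}(-1)^{k-j}\frac{2n-2j}{2n-k-j}\binom{2n-k-j}{k-j}J_{2n,j}, & 1\le k<n,\\[10pt] \displaystyle J_{2n,n}+\sum_{j=1}^{n-1}(-1)^{n-j}\frac{2n-2j}{n-j}\binom{n-j}{n-j}J_{2n,j}, & k=n,\end{cases}$$ and $b_{2n,k}=0$ if $k<1$ or $k>n$. Then for every $n\ge 1$ $$J_{2n}(t)=\sum_{k=1}^{n}b_{2n,k}\,t^k(1+t)^{2n-2k},$$ and the $b_{2n,k}$, $1\le k\le n$, are the only rational numbers with this property. Moreover, for all $n\ge 2$ and $k\ge 1$,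 $$2n\,b_{2n,k}=[k(k+1)+2n-2]\,b_{2n-2,k}+[2+2(k-1)(4n-4k-3)]\,b_{2n-2,k-1}+8(n-k+1)(2n-2k+1)\,b_{2n-2,k-2}.$$ -/

import Mathlib

open Polynomial

/-- The descent number of the word `π(1) π(2) ⋯ π(m)`: the number of positions `i`
followed by a position `j = i + 1` such that `π(i) > π(j)`. -/
def descentNumber {m : ℕ} (π : Equiv.Perm (Fin m)) : ℕ :=
  (Finset.univ.filter fun i : Fin m => ∃ j : Fin m, j.val = i.val + 1 ∧ π j < π i).card

/-- The fixed-point free involutions of an `m`-element set. -/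
def fixedPointFreeInvolutions (m : ℕ) : Finset (Equiv.Perm (Fin m)) :=
  Finset.univ.filter fun π => (∀ i, π (π i) = i) ∧ ∀ i, π i ≠ i

/-- The polynomial `J_m(t)`, the sum of `t ^ d(π)` over the fixed-point free involutions `π`. -/
noncomputable def jPoly (m : ℕ) : ℚ[X] :=
  ∑ π ∈ fixedPointFreeInvolutions m, X ^ descentNumber π

/-- The factor `(-1)^(k-j) * (2n-2j)/(2n-k-j) * binom(2n-k-j, k-j)`;
it is only used for `1 ≤ j ≤ k ≤ n` with `j < n`, so the denominator is positive and the
subtractions of natural numbers do not truncate. -/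
def bFactor (n k j : ℕ) : ℚ :=
  (-1) ^ (k - j) * ((2 * (n : ℚ) - 2 * j) / (2 * (n : ℚ) - k - j)) *
    ((2 * n - k - j).choose (k - j) : ℚ)

/-- The number `b_{2n,k}`, by its explicit formula in terms of the coefficients of `J_{2n}(t)`
if `1 ≤ k ≤ n`, and `0` if `k < 1` or `k > n`. -/
noncomputable def bCoeff (n : ℕ) (k : ℤ) : ℚ :=
  if 1 ≤ k ∧ k < n then
    ∑ j ∈ Finset.Icc 1 k.toNat, bFactor n k.toNat j * (jPoly (2 * n)).coeff j
  else if 1 ≤ k ∧ k = n then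
    (jPoly (2 * n)).coeff n + ∑ j ∈ Finset.Icc 1 (n - 1), bFactor n n j * (jPoly (2 * n)).coeff j
  else 0

/-! Everything rests on `J_{2n}(t) = (1-t)^(2n+1) ∑ r, h_n(r(r+1)/2) t^r`
(`jPoly_eq_mul_pairMultisetSeries`). Call a word `f` on `r+1` letters compatible with `π` if it
increases weakly, and strictly at the descents of `π`. Fixed `π` has `binom(2n+r-d(π), 2n)` such
words, the coefficient of `t^r` in `t^d(π)/(1-t)^(2n+1)`. On the other hand, `(π, f)` is determined
by the multiset of sets `{f k, f (π k)}`, one per 2-cycle, and every multiset of `n` two-element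
sets occurs (`card_compatible_pairs`).

The relation `(n+1) h_{n+1}(M) = (M+n) h_n(M)` at `M = r(r+1)/2` becomes a second-order differential
recurrence for `J_{2n}`. Its operator sends each `t^k (1+t)^(2n-2-2k)` to a combination of the three
polynomials `t^l (1+t)^(2n-2l)`, `l = k, k+1, k+2` (`jOperator_X_pow_mul`). By induction `J_{2n}`
has an expansion of the required form, whose coefficients obey the three-term recurrence.

Such an expansion makes `J_{2n}` palindromic, so it is a sum of terms `t^j (1 + t^(2n-2j))` and a
middle term. Waring's formula expands these, and uniqueness identifies the coefficients with
`b_{2n,k}`. -/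

/-! ### Waring's formula for `1 + X ^ (2 * N)` -/

/-- The term `(-1)^i * binom(j, i) * X^i * (1+X)^(j-i)`. -/
noncomputable def fibTerm (p : ℕ × ℕ) : ℚ[X] :=
  C ((-1) ^ p.1 * (p.2.choose p.1 : ℚ)) * X ^ p.1 * (1 + X) ^ (p.2 - p.1)

theorem fibTerm_succ_succ (i j : ℕ) :
    fibTerm (i + 1, j + 1) = (1 + X) * fibTerm (i + 1, j) - X * fibTerm (i, j) := by
  simp only [fibTerm, Nat.add_sub_add_right, Nat.choose_succ_succ' j i, Nat.cast_add, mul_add,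
    map_add, map_mul, map_pow, map_neg, map_one, map_natCast]
  rcases Nat.lt_or_ge i j with h | h
  · obtain ⟨e, rfl⟩ := Nat.exists_eq_add_of_lt h
    rw [show i + e + 1 - i = e + 1 by omega, show i + e + 1 - (i + 1) = e by omega]
    ring
  · rw [Nat.choose_eq_zero_of_lt (show j < i + 1 by omega)]
    push_cast
    ring

theorem sum_fibTerm_add_two (m : ℕ) :
    ∑ p ∈ Finset.HasAntidiagonal.antidiagonal (m + 2), fibTerm p =
      (1 + X) * ∑ p ∈ Finset.HasAntidiagonal.antidiagonal (m + 1), fibTerm p -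
        X * ∑ p ∈ Finset.HasAntidiagonal.antidiagonal m, fibTerm p := by
  rw [Finset.Nat.antidiagonal_succ_succ', Finset.Nat.antidiagonal_succ]
  simp only [Finset.sum_cons, Finset.sum_map, Function.Embedding.prodMap,
    Function.Embedding.coeFn_mk, Prod.map, Function.Embedding.refl_apply, Nat.succ_eq_add_one,
    fibTerm_succ_succ, Finset.sum_sub_distrib, ← Finset.mul_sum]
  have h0 : fibTerm (m + 2, 0) = 0 := by simp [fibTerm]
  have h1 : ∀ a, fibTerm (0, a) = (1 + X) ^ a := by simp [fibTerm]
  rw [h0, h1, h1]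
  ring

/-- Both sides are the complete homogeneous polynomial of degree `m` in `1` and `X`, on the left in
terms of `e₁ = 1 + X` and `e₂ = X`; they share the recurrence `h_{m+2} = e₁ h_{m+1} - e₂ h_m`. -/
theorem sum_fibTerm_eq_geom (m : ℕ) :
    ∑ p ∈ Finset.HasAntidiagonal.antidiagonal m, fibTerm p = ∑ i ∈ Finset.range (m + 1), (X : ℚ[X]) ^ i := by
  induction m using Nat.twoStepInduction with
  | zero => simp [fibTerm]
  | one => simp [fibTerm, Finset.Nat.antidiagonal_succ, Finset.sum_range_succ]
  | more m h1 h2 =>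
    rw [sum_fibTerm_add_two, h1, h2, Finset.sum_range_succ _ (m + 2), Finset.sum_range_succ _ (m + 1)]
    ring

theorem one_add_X_pow_eq_sum (N : ℕ) (hN : 1 ≤ N) :
    (1 + X ^ (2 * N) : ℚ[X]) = ∑ i ∈ Finset.range (N + 1),
      C ((-1) ^ i * ((2 * N : ℚ) / (2 * N - i)) * ((2 * N - i).choose i : ℚ)) *
        X ^ i * (1 + X) ^ (2 * N - 2 * i) := by
  obtain ⟨N, rfl⟩ := Nat.exists_eq_add_of_le' hN
  set m := 2 * N with hm
  have e : 2 * (N + 1) = m + 2 := by omega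
  have key : (1 + X ^ (m + 2) : ℚ[X]) = ∑ p ∈ Finset.HasAntidiagonal.antidiagonal (m + 2), fibTerm p -
      X * ∑ p ∈ Finset.HasAntidiagonal.antidiagonal m, fibTerm p := by
    rw [sum_fibTerm_eq_geom, sum_fibTerm_eq_geom, Finset.sum_range_succ, Finset.sum_range_succ']
    simp only [pow_succ, ← Finset.sum_mul, pow_zero]
    ring
  rw [e, key, Finset.Nat.antidiagonal_succ_succ', Finset.sum_range_succ']
  simp only [Finset.sum_cons, Finset.sum_map, Function.Embedding.prodMap,
    Function.Embedding.coeFn_mk, Prod.map, Nat.succ_eq_add_one]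
  have h0 : fibTerm (m + 2, 0) = 0 := by simp [fibTerm]
  have h1 : fibTerm (0, m + 2) = (1 + X) ^ (m + 2) := by simp [fibTerm]
  have hne : (2 * ((N + 1 : ℕ) : ℚ)) ≠ 0 := by positivity
  rw [h0, h1, Finset.mul_sum, zero_add, add_sub_assoc, ← Finset.sum_sub_distrib, add_comm]
  congr 1
  · rw [Finset.Nat.sum_antidiagonal_eq_sum_range_succ_mk]
    -- The antidiagonal also contains indices with `2 * i > m`, where both binomials vanish.
    symm
    apply Finset.sum_subset_zero_on_sdiff
    · intro x; simp only [Finset.mem_range]; omega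
    · intro i hi
      simp only [Finset.mem_sdiff, Finset.mem_range, not_lt] at hi
      simp only [fibTerm]
      rw [Nat.choose_eq_zero_of_lt (show m - i + 1 < i + 1 by omega),
        Nat.choose_eq_zero_of_lt (show m - i < i by omega)]
      simp
    · intro i hi
      rw [Finset.mem_range] at hi
      obtain ⟨e, he⟩ := Nat.exists_eq_add_of_le (show i ≤ m - i by omega)
      have hme : m = 2 * i + e := by omega
      simp only [fibTerm, he]
      rw [show m + 2 - (i + 1) = i + e + 1 by omega, show m + 2 - 2 * (i + 1) = e by omega,
        show i + e + 1 - (i + 1) = e by omega, show i + e - i = e by omega]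
      -- Waring's fraction arises from adding two binomials by absorption, `(a+1) * binom(a, i) =
      -- (i+1) * binom(a+1, i+1)` with `a = i + e`.
      have hc : ((-1 : ℚ) ^ (i + 1) * (2 * ((N + 1 : ℕ) : ℚ) / (2 * ((N + 1 : ℕ) : ℚ) - (i + 1 : ℕ))) *
          ((i + e + 1).choose (i + 1) : ℚ)) = (-1) ^ (i + 1) * ((i + e + 1).choose (i + 1) : ℚ) -
          (-1) ^ i * ((i + e).choose i : ℚ) := by
        have h2 : (2 * ((N + 1 : ℕ) : ℚ)) = 2 * i + e + 2 := by
          have : 2 * (N + 1) = 2 * i + e + 2 := by omega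
          exact_mod_cast this
        have h3 : ((i + e + 1 : ℕ) : ℚ) * ((i + e).choose i : ℚ) =
            ((i + e + 1).choose (i + 1) : ℚ) * ((i + 1 : ℕ) : ℚ) := by
          exact_mod_cast Nat.add_one_mul_choose_eq (i + e) i
        have h4 : (2 * i + e + 2 - ((i : ℚ) + 1)) ≠ 0 := by
          have : (2 * i + e + 2 - ((i : ℚ) + 1)) = i + e + 1 := by ring
          rw [this]; positivity
        rw [h2]
        push_cast at h3 ⊢
        field_simp
        rw [pow_succ]
        linear_combination (-1 : ℚ) ^ i * h3
      rw [hc, map_sub]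
      ring
  · have hs : (2 * ((N + 1 : ℕ) : ℚ)) / (2 * ((N + 1 : ℕ) : ℚ)) = 1 := div_self hne
    push_cast at hs
    simp [hs]

/-! ### Expansions in the polynomials `X ^ k * (1 + X) ^ (2 * n - 2 * k)` -/

theorem coeff_X_pow_mul_one_add_X_pow (k q j : ℕ) :
    (X ^ k * (1 + X) ^ q : ℚ[X]).coeff j = if k ≤ j then (q.choose (j - k) : ℚ) else 0 := by
  rw [coeff_X_pow_mul']
  split_ifs
  · rw [coeff_one_add_X_pow]
  · rfl

theorem coeff_expansion (n : ℕ) (c : ℕ → ℚ) (j : ℕ) :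
    (∑ k ∈ Finset.Icc 1 n, C (c k) * X ^ k * (1 + X) ^ (2 * n - 2 * k)).coeff j =
      ∑ k ∈ Finset.Icc 1 n,
        c k * if k ≤ j then ((2 * n - 2 * k).choose (j - k) : ℚ) else 0 := by
  rw [finsetSum_coeff]
  refine Finset.sum_congr rfl fun k _ => ?_
  rw [mul_assoc, coeff_C_mul, coeff_X_pow_mul_one_add_X_pow]

/-- The system is unitriangular: the `k`-th polynomial has lowest term `X ^ k`, with coefficient 1.
-/
theorem eq_of_expansion_eq {n : ℕ} {c d : ℕ → ℚ}
    (h : ∑ k ∈ Finset.Icc 1 n, C (c k) * X ^ k * (1 + X) ^ (2 * n - 2 * k) =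
      ∑ k ∈ Finset.Icc 1 n, C (d k) * X ^ k * (1 + X) ^ (2 * n - 2 * k)) :
    ∀ k ∈ Finset.Icc 1 n, c k = d k := by
  intro k
  induction k using Nat.strong_induction_on with
  | _ k ih =>
    intro hk
    have hc := congrArg (fun p => coeff p k) h
    simp only [coeff_expansion] at hc
    rw [← Finset.add_sum_erase _ _ hk, ← Finset.add_sum_erase _ _ hk] at hc
    have he : ∀ l ∈ (Finset.Icc 1 n).erase k,
        (c l * if l ≤ k then ((2 * n - 2 * l).choose (k - l) : ℚ) else 0) =
          d l * if l ≤ k then ((2 * n - 2 * l).choose (k - l) : ℚ) else 0 := by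
      intro l hl
      rw [Finset.mem_erase] at hl
      split_ifs with hlk
      · rw [ih l (lt_of_le_of_ne hlk hl.1) hl.2]
      · simp
    rw [Finset.sum_congr rfl he] at hc
    simpa using hc

theorem coeff_expansion_symm (n : ℕ) (c : ℕ → ℚ) (j : ℕ) (hj : j ≤ 2 * n) :
    (∑ k ∈ Finset.Icc 1 n, C (c k) * X ^ k * (1 + X) ^ (2 * n - 2 * k)).coeff (2 * n - j) =
      (∑ k ∈ Finset.Icc 1 n, C (c k) * X ^ k * (1 + X) ^ (2 * n - 2 * k)).coeff j := by
  simp only [coeff_expansion]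
  refine Finset.sum_congr rfl fun k hk => ?_
  rw [Finset.mem_Icc] at hk
  congr 1
  by_cases h1 : k ≤ j
  · by_cases h2 : k ≤ 2 * n - j
    · rw [if_pos h1, if_pos h2, ← Nat.choose_symm (show j - k ≤ 2 * n - 2 * k by omega)]
      congr 2
      omega
    · rw [if_pos h1, if_neg h2, Nat.choose_eq_zero_of_lt (by omega), Nat.cast_zero]
  · rw [if_neg h1, if_pos (by omega), Nat.choose_eq_zero_of_lt (by omega), Nat.cast_zero]

theorem natDegree_expansion_lt (n : ℕ) (c : ℕ → ℚ) :
    (∑ k ∈ Finset.Icc 1 n, C (c k) * X ^ k * (1 + X) ^ (2 * n - 2 * k)).natDegree <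
      2 * n + 1 := by
  rw [Nat.lt_succ_iff, natDegree_le_iff_coeff_eq_zero]
  intro j hj
  rw [coeff_expansion]
  refine Finset.sum_eq_zero fun k hk => ?_
  rw [Finset.mem_Icc] at hk
  split_ifs
  · rw [Nat.choose_eq_zero_of_lt (by omega), Nat.cast_zero, mul_zero]
  · exact mul_zero _

theorem eq_sum_of_coeff_symm {n : ℕ} (p : ℚ[X]) (hn : 1 ≤ n) (h0 : p.coeff 0 = 0)
    (hs : ∀ j ≤ 2 * n, p.coeff (2 * n - j) = p.coeff j) (hd : p.natDegree < 2 * n + 1) :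
    p = ∑ j ∈ Finset.Icc 1 (n - 1), C (p.coeff j) * (X ^ j * (1 + X ^ (2 * (n - j)))) +
      C (p.coeff n) * X ^ n := by
  conv_lhs => rw [as_sum_range_C_mul_X_pow' p hd]
  rw [show 2 * n + 1 = n + 1 + n by ring, Finset.sum_range_add, Finset.sum_range_succ,
    ← Finset.sum_range_reflect (fun x => C (p.coeff (n + 1 + x)) * X ^ (n + 1 + x)),
    add_right_comm, ← Finset.sum_add_distrib]
  congr 1
  symm
  have hsub : Finset.Icc 1 (n - 1) ⊆ Finset.range n := by
    intro x
    simp only [Finset.mem_Icc, Finset.mem_range]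
    omega
  refine Finset.sum_subset_zero_on_sdiff hsub ?_ ?_
  · intro x hx
    simp only [Finset.mem_sdiff, Finset.mem_Icc, Finset.mem_range] at hx
    obtain rfl : x = 0 := by omega
    have : p.coeff (n + 1 + (n - 1 - 0)) = 0 := by
      rw [show n + 1 + (n - 1 - 0) = 2 * n - 0 by omega, hs 0 (by omega), h0]
    rw [this, h0]
    simp
  · intro j hj
    rw [Finset.mem_Icc] at hj
    rw [show n + 1 + (n - 1 - j) = 2 * n - j by omega, hs j (by omega),
      show 2 * n - j = j + 2 * (n - j) by omega]
    ring

theorem X_pow_mul_one_add_X_pow_eq_sum {n j : ℕ} (hj : j < n) :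
    (X ^ j * (1 + X ^ (2 * (n - j))) : ℚ[X]) =
      ∑ k ∈ Finset.Icc j n, C (bFactor n k j) * X ^ k * (1 + X) ^ (2 * n - 2 * k) := by
  rw [one_add_X_pow_eq_sum (n - j) (by omega), Finset.mul_sum,
    show Finset.Icc j n = Finset.Ico j (n + 1) by ext; simp,
    Finset.sum_Ico_eq_sum_range, show n - j + 1 = n + 1 - j by omega]
  refine Finset.sum_congr rfl fun i hi => ?_
  rw [Finset.mem_range] at hi
  have hb : bFactor n (j + i) j = (-1) ^ i * ((2 * ((n - j : ℕ) : ℚ)) /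
      (2 * ((n - j : ℕ) : ℚ) - i)) * ((2 * (n - j) - i).choose i : ℚ) := by
    rw [bFactor, show j + i - j = i by omega, show 2 * n - (j + i) - j = 2 * (n - j) - i by omega,
      Nat.cast_sub hj.le]
    push_cast
    congr 3
    · ring
    · ring
  rw [hb, show 2 * n - 2 * (j + i) = 2 * (n - j) - 2 * i by omega]
  ring

/-- Puts both cases into one formula. The index `j = n` is left out because its factor would be `0 /
0`; the middle coefficient enters separately. -/
theorem bCoeff_eq_sum_min {n k : ℕ} (hk : 1 ≤ k) (hkn : k ≤ n) :
    bCoeff n k = ∑ j ∈ Finset.Icc 1 (min k (n - 1)), bFactor n k j * (jPoly (2 * n)).coeff j +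
      if k = n then (jPoly (2 * n)).coeff n else 0 := by
  rw [bCoeff]
  rcases hkn.lt_or_eq with h | rfl
  · rw [if_pos ⟨by exact_mod_cast hk, by exact_mod_cast h⟩, if_neg h.ne, add_zero, Int.toNat_natCast,
      min_eq_left (by omega)]
  · rw [if_neg (by simp), if_pos ⟨by exact_mod_cast hk, rfl⟩, if_pos rfl, min_eq_right (by omega),
      add_comm]

/-- The assumed expansion itself supplies the symmetry, degree bound and zero constant term needed
to fold the polynomial. Waring's formula and an exchange of sums over `j ≤ k` then give a second
expansion. -/
theorem eq_bCoeff_of_jPoly_eq {n : ℕ} (hn : 1 ≤ n) {c : ℕ → ℚ}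
    (h : jPoly (2 * n) = ∑ k ∈ Finset.Icc 1 n, C (c k) * X ^ k * (1 + X) ^ (2 * n - 2 * k)) :
    ∀ k ∈ Finset.Icc 1 n, c k = bCoeff n k := by
  apply eq_of_expansion_eq
  rw [← h]
  have hp := eq_sum_of_coeff_symm (jPoly (2 * n)) hn ?_ ?_ ?_
  · rw [hp]
    have h1 : ∀ j ∈ Finset.Icc 1 (n - 1),
        C ((jPoly (2 * n)).coeff j) * (X ^ j * (1 + X ^ (2 * (n - j)))) =
          ∑ k ∈ Finset.Icc j n, C (bFactor n k j * (jPoly (2 * n)).coeff j) *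
            (X ^ k * (1 + X) ^ (2 * n - 2 * k)) := by
      intro j hj
      rw [Finset.mem_Icc] at hj
      rw [X_pow_mul_one_add_X_pow_eq_sum (by omega), Finset.mul_sum]
      refine Finset.sum_congr rfl fun k _ => ?_
      rw [C_mul]
      ring
    rw [Finset.sum_congr rfl h1, Finset.sum_comm' (t' := Finset.Icc 1 n)
      (s' := fun k => Finset.Icc 1 (min k (n - 1)))]
    · have h2 : ∀ k ∈ Finset.Icc 1 n,
          C (bCoeff n k) * X ^ k * (1 + X) ^ (2 * n - 2 * k) =
            (∑ j ∈ Finset.Icc 1 (min k (n - 1)), C (bFactor n k j * (jPoly (2 * n)).coeff j) *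
              (X ^ k * (1 + X) ^ (2 * n - 2 * k))) +
              if k = n then C ((jPoly (2 * n)).coeff n) * X ^ n else 0 := by
        intro k hk
        rw [Finset.mem_Icc] at hk
        rw [bCoeff_eq_sum_min hk.1 hk.2, C_add, map_sum, mul_assoc, add_mul, Finset.sum_mul]
        congr 1
        split_ifs with hkn
        · simp [hkn]
        · simp
      rw [Finset.sum_congr rfl h2, Finset.sum_add_distrib]
      congr 1
      rw [Finset.sum_ite_eq' _ n, if_pos (by simpa using hn)]
    · intro j k
      simp only [Finset.mem_Icc]
      omega
  · rw [h, coeff_expansion]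
    refine Finset.sum_eq_zero fun k hk => ?_
    rw [Finset.mem_Icc] at hk
    rw [if_neg (by omega), mul_zero]
  · intro j hj
    rw [h, coeff_expansion_symm n c j hj]
  · rw [h]
    exact natDegree_expansion_lt n c

/-! ### The differential recurrence for `J_{2n}(t)` -/

/-- The differential operator taking `J_{2n-2}(t)` to `2n J_{2n}(t)`, for `n = m + 2`. -/
noncomputable def jOperator (m : ℕ) : ℚ[X] →ₗ[ℚ] ℚ[X] :=
  (LinearMap.mulLeft ℚ (X ^ 2 * (1 - X) ^ 2)) ∘ₗ derivative ∘ₗ derivative +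
  (LinearMap.mulLeft ℚ (2 * (2 * (m : ℚ[X]) + 3) * X ^ 2 * (1 - X) + 2 * X * (1 - X) ^ 2)) ∘ₗ
    derivative +
  LinearMap.mulLeft ℚ ((2 * (m : ℚ[X]) + 3) * (2 * (m : ℚ[X]) + 4) * X ^ 2 +
    2 * (2 * (m : ℚ[X]) + 3) * X * (1 - X) + (2 * (m : ℚ[X]) + 2) * (1 - X) ^ 2)

theorem jOperator_apply (m : ℕ) (p : ℚ[X]) :
    jOperator m p = X ^ 2 * (1 - X) ^ 2 * derivative (derivative p) +
      (2 * (2 * (m : ℚ[X]) + 3) * X ^ 2 * (1 - X) + 2 * X * (1 - X) ^ 2) * derivative p +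
      ((2 * (m : ℚ[X]) + 3) * (2 * (m : ℚ[X]) + 4) * X ^ 2 +
        2 * (2 * (m : ℚ[X]) + 3) * X * (1 - X) + (2 * (m : ℚ[X]) + 2) * (1 - X) ^ 2) * p := by
  simp only [jOperator, LinearMap.add_apply, LinearMap.comp_apply, LinearMap.mulLeft_apply]

theorem mul_derivative_pow (p : ℚ[X]) (k : ℕ) :
    p * derivative (p ^ k) = (k : ℚ[X]) * p ^ k * derivative p := by
  cases k with
  | zero => simp
  | succ k =>
    rw [derivative_pow_succ, map_add, map_natCast, map_one]
    push_cast
    ring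

theorem jOperator_X_pow_mul (m k s : ℕ) (h : k + s = m + 1) :
    jOperator m (X ^ k * (1 + X) ^ (2 * s)) =
      ((k : ℚ[X]) * ((k : ℚ[X]) + 1) + 2 * (m : ℚ[X]) + 2) * (X ^ k * (1 + X) ^ (2 * (s + 1))) +
      (2 + 2 * (k : ℚ[X]) * (4 * (s : ℚ[X]) - 3)) * (X ^ (k + 1) * (1 + X) ^ (2 * s)) +
      (8 * (s : ℚ[X]) * (2 * (s : ℚ[X]) - 1)) * (X ^ (k + 2) * (1 + X) ^ (2 * (s - 1))) := by
  have hm : (m : ℚ[X]) = (k : ℚ[X]) + (s : ℚ[X]) - 1 := by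
    have : ((k + s : ℕ) : ℚ[X]) = ((m + 1 : ℕ) : ℚ[X]) := by rw [h]
    push_cast at this
    linear_combination -this
  -- `X * D` and `X ^ 2 * D ^ 2` act diagonally on `X ^ k`, which avoids the exponents `k - 1` and
  -- `k - 2`.
  have h1 : X * derivative (X ^ k : ℚ[X]) = (k : ℚ[X]) * X ^ k := by
    rw [mul_derivative_pow, derivative_X, mul_one]
  have h2 : X ^ 2 * derivative (derivative (X ^ k : ℚ[X])) = ((k : ℚ[X]) * ((k : ℚ[X]) - 1)) * X ^ k := by
    have := congrArg derivative h1
    simp only [derivative_mul, derivative_X, derivative_natCast] at this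
    linear_combination X * this + ((k : ℚ[X]) - 1) * h1
  rw [jOperator_apply, hm]
  generalize hA : (X ^ k : ℚ[X]) = A at *
  rw [pow_succ X (k + 1), pow_succ X k, hA]
  -- For `s = 0` the exponent `2 * (s - 1)` truncates, but its coefficient vanishes.
  cases s with
  | zero =>
    simp only [mul_zero, pow_zero, mul_one, Nat.cast_zero]
    linear_combination (1 - X) ^ 2 * h2 +
      (2 * (2 * ((k : ℚ[X]) - 1) + 3) * X * (1 - X) + 2 * (1 - X) ^ 2) * h1
  | succ s =>
    have e1 : derivative ((1 + X) ^ (2 * (s + 1)) : ℚ[X]) =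
        (2 * (s : ℚ[X]) + 2) * ((1 + X) ^ (2 * s) * (1 + X)) := by
      rw [show 2 * (s + 1) = 2 * s + 1 + 1 by ring, derivative_pow_succ, map_add, map_natCast,
        map_one, derivative_add, derivative_one, derivative_X]
      push_cast
      ring
    have e2 : (1 + X) * derivative ((1 + X) ^ (2 * s) : ℚ[X]) =
        2 * (s : ℚ[X]) * (1 + X) ^ (2 * s) := by
      rw [mul_derivative_pow, derivative_add, derivative_one, derivative_X]
      push_cast
      ring
    have e3 : ((1 + X) ^ (2 * (s + 1)) : ℚ[X]) = (1 + X) ^ (2 * s) * (1 + X) ^ 2 := by ring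
    have e4 : ((1 + X) ^ (2 * (s + 1 + 1)) : ℚ[X]) = (1 + X) ^ (2 * s) * (1 + X) ^ 4 := by ring
    simp only [derivative_mul, derivative_add, e1, derivative_natCast, derivative_one,
      derivative_X, derivative_ofNat]
    rw [e3, e4, Nat.add_sub_cancel]
    generalize derivative ((1 + X) ^ (2 * s) : ℚ[X]) = B' at *
    generalize ((1 + X) ^ (2 * s) : ℚ[X]) = B at *
    generalize derivative (derivative A) = A2 at *
    generalize derivative A = A1 at *
    push_cast
    linear_combination (1 - X) ^ 2 * B * (1 + X) ^ 2 * h2 +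
      (2 * (1 - X) ^ 2 * X * (2 * (s : ℚ[X]) + 2) * B * (1 + X) +
        (2 * (2 * ((k : ℚ[X]) + ((s : ℚ[X]) + 1) - 1) + 3) * X * (1 - X) + 2 * (1 - X) ^ 2) * B * (1 + X) ^ 2)
        * h1 + (X ^ 2 * (1 - X) ^ 2 * A * (2 * (s : ℚ[X]) + 2)) * e2

/-- The right-hand side of the recurrence, for a sequence `c`, with `n = m + 2`. -/
def recurrenceSum (m : ℕ) (c : ℤ → ℚ) (k : ℤ) : ℚ :=
  ((k : ℚ) * (k + 1) + 2 * m + 2) * c k +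
    (2 + 2 * ((k : ℚ) - 1) * (4 * m - 4 * k + 5)) * c (k - 1) +
    8 * ((m : ℚ) - k + 3) * (2 * (m : ℚ) - 2 * k + 5) * c (k - 2)

theorem jOperator_expansion (m : ℕ) (c : ℤ → ℚ) (h0 : ∀ k ≤ 0, c k = 0)
    (h1 : ∀ k : ℤ, m + 1 < k → c k = 0) :
    jOperator m (∑ k ∈ Finset.Icc 1 (m + 1),
        C (c k) * X ^ k * (1 + X) ^ (2 * (m + 1) - 2 * k)) =
      ∑ k ∈ Finset.Icc 1 (m + 2),
        C (recurrenceSum m c k) * X ^ k * (1 + X) ^ (2 * (m + 2) - 2 * k) := by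
  have hr : ∀ N, ∀ f : ℕ → ℚ[X], ∑ k ∈ Finset.Icc 1 N, f k = ∑ i ∈ Finset.range N, f (i + 1) := by
    intro N f
    rw [show Finset.Icc 1 N = Finset.Ico 1 (N + 1) by ext; simp,
      Finset.sum_Ico_eq_sum_range]
    exact Finset.sum_congr rfl fun i _ => by rw [add_comm]
  let F : ℕ → ℚ[X] := fun k => X ^ k * (1 + X) ^ (2 * (m + 2) - 2 * k)
  let A : ℕ → ℚ[X] := fun k => C (((k : ℚ) * (k + 1) + 2 * m + 2) * c k) * F k
  let B : ℕ → ℚ[X] := fun k => C ((2 + 2 * (k : ℚ) * (4 * m - 4 * k + 1)) * c k) * F (k + 1)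
  let G : ℕ → ℚ[X] := fun k =>
    C (8 * ((m : ℚ) - k + 1) * (2 * m - 2 * k + 1) * c k) * F (k + 2)
  -- These boundary values vanish, so the three sums can be shifted to a common index range.
  have hA : A (m + 2) = 0 := by
    simp only [A]
    rw [h1 _ (by push_cast; omega)]
    simp
  have hB : B 0 = 0 := by
    simp only [B]
    rw [h0 _ (by simp)]
    simp
  have hG0 : G 0 = 0 := by
    simp only [G]
    rw [h0 _ (by simp)]
    simp
  have hGm : G (m + 1) = 0 := by
    simp only [G]
    push_cast
    simp
  have hL : jOperator m (∑ k ∈ Finset.Icc 1 (m + 1),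
      C (c k) * X ^ k * (1 + X) ^ (2 * (m + 1) - 2 * k)) =
      ∑ i ∈ Finset.range (m + 1), (A (i + 1) + B (i + 1) + G (i + 1)) := by
    rw [map_sum, hr]
    refine Finset.sum_congr rfl fun i hi => ?_
    rw [Finset.mem_range] at hi
    obtain ⟨s, rfl⟩ := Nat.exists_eq_add_of_le (show i ≤ m by omega)
    rw [mul_assoc, ← smul_eq_C_mul, map_smul, smul_eq_C_mul,
      show 2 * (i + s + 1) - 2 * (i + 1) = 2 * s by omega, jOperator_X_pow_mul _ _ s (by omega)]
    simp only [A, B, G, F]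
    rw [show 2 * (i + s + 2) - 2 * (i + 1) = 2 * (s + 1) by omega,
      show 2 * (i + s + 2) - 2 * (i + 1 + 1) = 2 * s by omega,
      show 2 * (i + s + 2) - 2 * (i + 1 + 2) = 2 * (s - 1) by omega]
    simp only [map_mul, map_add, map_sub, map_natCast, Nat.cast_add, Nat.cast_one, map_one,
      map_ofNat]
    ring
  have hR : ∀ i : ℕ, C (recurrenceSum m c ((i + 1 : ℕ) : ℤ)) * X ^ (i + 1) *
      (1 + X) ^ (2 * (m + 2) - 2 * (i + 1)) = A (i + 1) + B i +
        C (8 * ((m : ℚ) - i + 2) * (2 * m - 2 * i + 3) * c ((i : ℤ) - 1)) * F (i + 1) := by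
    intro i
    simp only [A, B, F, recurrenceSum]
    rw [show (((i + 1 : ℕ) : ℤ) - 1) = (i : ℤ) by push_cast; ring,
      show (((i + 1 : ℕ) : ℤ) - 2) = (i : ℤ) - 1 by push_cast; ring]
    simp only [map_mul, map_add, map_sub, map_natCast, Nat.cast_add, Nat.cast_one, map_one,
      map_ofNat, Int.cast_add, Int.cast_natCast, Int.cast_one]
    ring
  rw [hL, hr]
  simp only [hR, Finset.sum_add_distrib]
  have s1 := Finset.sum_range_succ (fun i => A (i + 1)) (m + 1)
  have s2 := Finset.sum_range_succ' B (m + 1)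
  have s3 : ∑ i ∈ Finset.range (m + 1 + 1),
      C (8 * ((m : ℚ) - i + 2) * (2 * m - 2 * i + 3) * c ((i : ℤ) - 1)) * F (i + 1) =
      ∑ i ∈ Finset.range (m + 1), G i := by
    rw [Finset.sum_range_succ', h0 _ (by simp)]
    simp only [mul_zero, map_zero, zero_mul, add_zero]
    refine Finset.sum_congr rfl fun i _ => ?_
    simp only [G]
    rw [show (((i + 1 : ℕ) : ℤ) - 1) = (i : ℤ) by push_cast; ring]
    congr 3
    push_cast
    ring
  have s4 := Finset.sum_range_succ' G (m + 1)
  rw [Finset.sum_range_succ G (m + 1), hGm, hG0, add_zero, add_zero] at s4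
  rw [hB, add_zero] at s2
  rw [hA, add_zero] at s1
  rw [s1, s2, s3, s4]

theorem jPoly_two : jPoly 2 = X := by
  have h : fixedPointFreeInvolutions 2 = {Equiv.swap 0 1} := by decide
  have hd : descentNumber (Equiv.swap (0 : Fin 2) 1) = 1 := by decide
  rw [jPoly, h, Finset.sum_singleton, hd, pow_one]

/-! ### The multiset series and its differential equation -/

/-- The series `∑ r, h_n(r(r+1)/2) t^r`, where `h_n(M)` counts the multisets of size `n` on
`M` letters. -/
noncomputable def pairMultisetSeries (n : ℕ) : PowerSeries ℚ :=
  PowerSeries.mk fun r => (((r + 1).choose 2).multichoose n : ℚ)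

theorem succ_mul_multichoose_succ (M n : ℕ) :
    (n + 1) * M.multichoose (n + 1) = (M + n) * M.multichoose n := by
  rcases Nat.eq_zero_or_pos M with rfl | hM
  · cases n <;> simp
  · obtain ⟨M, rfl⟩ := Nat.exists_eq_add_of_le' hM
    rw [Nat.multichoose_eq, Nat.multichoose_eq, show M + 1 + (n + 1) - 1 = M + n + 1 by omega,
      show M + 1 + n - 1 = M + n by omega, mul_comm, ← Nat.add_one_mul_choose_eq]
    ring

open PowerSeries in
theorem coeff_X_mul_derivative (f : PowerSeries ℚ) (r : ℕ) :
    PowerSeries.coeff r (PowerSeries.X * d⁄dX ℚ f) = r * PowerSeries.coeff r f := by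
  cases r with
  | zero => simp
  | succ r =>
    rw [PowerSeries.coeff_succ_X_mul, PowerSeries.coeff_derivative]
    push_cast
    ring

open PowerSeries in
-- On the coefficient of `X ^ r`, `X ^ 2 * D ^ 2 + 2 * X * D` multiplies by `r(r-1) + 2r = r(r+1)`,
-- twice the number of letters.
theorem pairMultisetSeries_succ (n : ℕ) :
    (2 * (n : PowerSeries ℚ) + 2) * pairMultisetSeries (n + 1) =
      PowerSeries.X ^ 2 * d⁄dX ℚ (d⁄dX ℚ (pairMultisetSeries n)) +
        2 * (PowerSeries.X * d⁄dX ℚ (pairMultisetSeries n)) +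
        2 * (n : PowerSeries ℚ) * pairMultisetSeries n := by
  have e : PowerSeries.X ^ 2 * d⁄dX ℚ (d⁄dX ℚ (pairMultisetSeries n)) =
      PowerSeries.X * d⁄dX ℚ (PowerSeries.X * d⁄dX ℚ (pairMultisetSeries n)) -
        PowerSeries.X * d⁄dX ℚ (pairMultisetSeries n) := by
    rw [Derivation.leibniz, PowerSeries.derivative_X, smul_eq_mul, smul_eq_mul]
    ring
  have c1 : (2 * (n : PowerSeries ℚ) + 2) = PowerSeries.C (2 * (n : ℚ) + 2) := by
    rw [map_add, map_mul, map_ofNat, map_natCast]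
  have c2 : 2 * (n : PowerSeries ℚ) = PowerSeries.C (2 * (n : ℚ)) := by
    rw [map_mul, map_ofNat, map_natCast]
  rw [e, c1, c2, two_mul (PowerSeries.X * _)]
  ext r
  simp only [LinearMap.map_add, LinearMap.map_sub, PowerSeries.coeff_C_mul, coeff_X_mul_derivative]
  simp only [pairMultisetSeries, PowerSeries.coeff_mk]
  have h := succ_mul_multichoose_succ ((r + 1).choose 2) n
  have h2 : (((r + 1).choose 2 : ℕ) : ℚ) = (r + 1) * r / 2 := by
    rw [Nat.cast_choose_two]
    push_cast
    ring
  have h' : ((n : ℚ) + 1) * (((r + 1).choose 2).multichoose (n + 1) : ℚ) =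
      ((r + 1) * r / 2 + n) * (((r + 1).choose 2).multichoose n : ℚ) := by
    rw [← h2]
    exact_mod_cast h
  linear_combination 2 * h'

open PowerSeries in
-- `jOperator` is the operator of `pairMultisetSeries_succ` conjugated by the powers of `1 - X` in
-- `hJ`; the identity is that equation times `(1 - X) ^ (2 * m + 5)`.
theorem jPoly_succ_eq (hJ : ∀ n, (jPoly (2 * n) : PowerSeries ℚ) =
      (1 - PowerSeries.X) ^ (2 * n + 1) * pairMultisetSeries n) (m : ℕ) :
    (2 * (m : ℚ[X]) + 4) * jPoly (2 * (m + 2)) = jOperator m (jPoly (2 * (m + 1))) := by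
  apply Polynomial.coe_injective ℚ
  rw [jOperator_apply]
  have h1 : ∀ k : ℕ, d⁄dX ℚ ((1 - PowerSeries.X : PowerSeries ℚ) ^ (k + 1)) =
      - ((k : PowerSeries ℚ) + 1) * (1 - PowerSeries.X) ^ k := by
    intro k
    rw [PowerSeries.derivative_pow]
    simp
    ring
  have hn : ∀ k : ℕ, (((k : ℚ[X]) : ℚ[X]) : PowerSeries ℚ) = k :=
    map_natCast (Polynomial.coeToPowerSeries.ringHom (R := ℚ))
  have ho : ∀ k : ℕ, [k.AtLeastTwo] →
      (((OfNat.ofNat k : ℚ[X]) : ℚ[X]) : PowerSeries ℚ) = OfNat.ofNat k := by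
    intro k _
    exact map_ofNat (Polynomial.coeToPowerSeries.ringHom (R := ℚ)) k
  have hs := pairMultisetSeries_succ (m + 1)
  simp only [Polynomial.coe_add, Polynomial.coe_mul, Polynomial.coe_sub, Polynomial.coe_pow,
    Polynomial.coe_X, Polynomial.coe_one, ← PowerSeries.derivative_coe, hn, ho]
  rw [hJ, hJ, show 2 * (m + 1) + 1 = 2 * m + 1 + 1 + 1 by ring,
    show 2 * (m + 2) + 1 = 2 * m + 1 + 4 by ring]
  simp only [Derivation.leibniz, smul_eq_mul, h1, map_add, map_neg, Derivation.map_natCast,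
    Derivation.map_one_eq_zero]
  generalize d⁄dX ℚ (d⁄dX ℚ (pairMultisetSeries (m + 1))) = G2 at *
  generalize d⁄dX ℚ (pairMultisetSeries (m + 1)) = G1 at *
  rw [pow_add _ (2 * m + 1) 4, pow_succ _ (2 * m + 1 + 1), pow_succ _ (2 * m + 1)]
  generalize (1 - PowerSeries.X : PowerSeries ℚ) ^ (2 * m + 1) = U at *
  push_cast at hs ⊢
  linear_combination U * (1 - PowerSeries.X) ^ 4 * hs

/-! ### Induction for the expansion and the recurrence -/

theorem expansion_step (hJ : ∀ n, (jPoly (2 * n) : PowerSeries ℚ) =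
      (1 - PowerSeries.X) ^ (2 * n + 1) * pairMultisetSeries n) (m : ℕ)
    (h : jPoly (2 * (m + 1)) = ∑ k ∈ Finset.Icc 1 (m + 1),
      C (bCoeff (m + 1) k) * X ^ k * (1 + X) ^ (2 * (m + 1) - 2 * k)) :
    jPoly (2 * (m + 2)) = ∑ k ∈ Finset.Icc 1 (m + 2),
      C (recurrenceSum m (bCoeff (m + 1)) k / (2 * m + 4)) * X ^ k *
        (1 + X) ^ (2 * (m + 2) - 2 * k) := by
  have h1 := jPoly_succ_eq hJ m
  rw [h, jOperator_expansion] at h1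
  · have h2 : (2 * (m : ℚ) + 4) ≠ 0 := by positivity
    have h3 : (2 * (m : ℚ[X]) + 4) = C (2 * (m : ℚ) + 4) := by
      rw [map_add, map_mul, map_ofNat, map_ofNat, map_natCast]
    have h4 : (2 * (m : ℚ[X]) + 4) ≠ 0 := by
      rw [h3]
      exact C_ne_zero.2 h2
    apply mul_left_cancel₀ h4
    rw [h1, Finset.mul_sum, h3]
    refine Finset.sum_congr rfl fun k _ => ?_
    rw [← mul_assoc, ← mul_assoc, ← C_mul, mul_div_cancel₀ _ h2]
  · intro k hk
    rw [bCoeff, if_neg (by omega), if_neg (by omega)]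
  · intro k hk
    rw [bCoeff, if_neg (by push_cast; omega), if_neg (by push_cast; omega)]

theorem jPoly_eq_expansion (hJ : ∀ n, (jPoly (2 * n) : PowerSeries ℚ) =
      (1 - PowerSeries.X) ^ (2 * n + 1) * pairMultisetSeries n) (m : ℕ) :
    jPoly (2 * (m + 1)) = ∑ k ∈ Finset.Icc 1 (m + 1),
      C (bCoeff (m + 1) k) * X ^ k * (1 + X) ^ (2 * (m + 1) - 2 * k) := by
  induction m with
  | zero => simp [jPoly_two, bCoeff]
  | succ m ih =>
    have h := expansion_step hJ m ih
    have hb := eq_bCoeff_of_jPoly_eq (by omega) h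
    rw [h]
    exact Finset.sum_congr rfl fun k hk => by rw [hb k hk]

theorem bCoeff_recurrence (hJ : ∀ n, (jPoly (2 * n) : PowerSeries ℚ) =
      (1 - PowerSeries.X) ^ (2 * n + 1) * pairMultisetSeries n) (m : ℕ) (k : ℤ) (hk : 1 ≤ k) :
    (2 * (m : ℚ) + 4) * bCoeff (m + 2) k = recurrenceSum m (bCoeff (m + 1)) k := by
  have h0 : ∀ j : ℤ, m + 1 < j → bCoeff (m + 1) j = 0 := by
    intro j hj
    rw [bCoeff, if_neg (by push_cast; omega), if_neg (by push_cast; omega)]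
  rcases lt_or_ge (m + 2 : ℤ) k with hlt | hle
  · have hz : bCoeff (m + 2) k = 0 := by
      rw [bCoeff, if_neg (by push_cast; omega), if_neg (by push_cast; omega)]
    rw [hz, recurrenceSum, h0 k (by omega), h0 (k - 1) (by omega)]
    -- At `k = m + 3` the value at `k - 2` need not vanish, but its factor `m - k + 3` does.
    rcases eq_or_ne k (m + 3) with rfl | hne
    · push_cast
      ring
    · rw [h0 (k - 2) (by omega)]
      ring
  · lift k to ℕ using by omega
    have h := expansion_step hJ m (jPoly_eq_expansion hJ m)
    rw [← eq_bCoeff_of_jPoly_eq (by omega) h k (by rw [Finset.mem_Icc]; omega)]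
    have h2 : (2 * (m : ℚ) + 4) ≠ 0 := by positivity
    rw [mul_div_cancel₀ _ h2]

/-! ### Sorted words and multisets -/

theorem eq_of_monotone_of_map_eq {α : Type*} [LinearOrder α] {m : ℕ} {v w : Fin m → α}
    (hv : Monotone v) (hw : Monotone w)
    (h : Finset.univ.val.map v = Finset.univ.val.map w) : v = w := by
  rw [Fin.univ_val_map, Fin.univ_val_map, Multiset.coe_eq_coe] at h
  exact List.ofFn_injective (h.eq_of_sortedLE hv.sortedLE_ofFn hw.sortedLE_ofFn)

theorem exists_monotone_map_eq {α : Type*} [LinearOrder α] (s : Multiset α) {m : ℕ}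
    (hs : s.card = m) : ∃ w : Fin m → α, Monotone w ∧ Finset.univ.val.map w = s := by
  subst hs
  have hl : (s.sort (· ≤ ·)).length = s.card := Multiset.length_sort (· ≤ ·)
  rw [← hl]
  refine ⟨(s.sort (· ≤ ·)).get, ?_, ?_⟩
  · exact (List.Pairwise.sortedLE (s.pairwise_sort (· ≤ ·))).monotone_get
  · rw [Fin.univ_val_map, List.ofFn_get, Multiset.sort_eq]

theorem card_monotone_fin (m N : ℕ) :
    (Finset.univ.filter fun h : Fin m → Fin N => Monotone h).card = N.multichoose m := by
  rw [← Sym.card_sym_fin_eq_multichoose, ← Finset.card_univ]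
  refine Finset.card_bij (fun h _ => Sym.mk (Finset.univ.val.map h) (by simp)) ?_ ?_ ?_
  · intros
    exact Finset.mem_univ _
  · intro v hv w hw h
    rw [Finset.mem_filter] at hv hw
    exact eq_of_monotone_of_map_eq hv.2 hw.2 (congrArg Subtype.val h)
  · intro s _
    obtain ⟨w, hw, hws⟩ := exists_monotone_map_eq s.1 s.2
    exact ⟨w, by simpa using hw, Subtype.ext hws⟩

/-! ### Words compatible with a permutation -/

/-- `f` is weakly increasing, and strictly increasing at the descents of `π`. -/
def IsCompatible {m R : ℕ} (π : Equiv.Perm (Fin m)) (f : Fin m → Fin R) : Prop :=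
  StrictMono fun k => toLex (f k, π k)

theorem isCompatible_iff_succ {m R : ℕ} (π : Equiv.Perm (Fin (m + 1))) (f : Fin (m + 1) → Fin R) :
    IsCompatible π f ↔ ∀ i : Fin m,
      (f i.castSucc : ℕ) + (if π i.succ < π i.castSucc then 1 else 0) ≤ f i.succ := by
  rw [IsCompatible, Fin.strictMono_iff_lt_succ]
  refine forall_congr' fun i => ?_
  rw [Prod.Lex.toLex_lt_toLex]
  have hne : π i.castSucc ≠ π i.succ := fun h => (Fin.castSucc_lt_succ (i := i)).ne (π.injective h)
  simp only [Fin.lt_def, Fin.ext_iff] at hne ⊢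
  split_ifs <;> omega

/-- The number of descents of `π` before position `k`. -/
def descentsBefore {m : ℕ} (π : Equiv.Perm (Fin m)) (k : Fin m) : ℕ :=
  (Finset.univ.filter fun i : Fin m => i < k ∧ ∃ j : Fin m, j.val = i.val + 1 ∧ π j < π i).card

theorem descentsBefore_zero {m : ℕ} (π : Equiv.Perm (Fin (m + 1))) : descentsBefore π 0 = 0 := by
  simp [descentsBefore]

theorem descentsBefore_succ {m : ℕ} (π : Equiv.Perm (Fin (m + 1))) (i : Fin m) :
    descentsBefore π i.succ =
      descentsBefore π i.castSucc + if π i.succ < π i.castSucc then 1 else 0 := by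
  have hd : (∃ j : Fin (m + 1), j.val = i.castSucc.val + 1 ∧ π j < π i.castSucc) ↔
      π i.succ < π i.castSucc := by
    constructor
    · rintro ⟨j, hj, h⟩
      obtain rfl : j = i.succ := Fin.ext (by simpa using hj)
      exact h
    · exact fun h => ⟨i.succ, by simp, h⟩
  have hlt : ∀ k : Fin (m + 1), k < i.succ ↔ k < i.castSucc ∨ k = i.castSucc := by
    intro k
    simp only [Fin.lt_def, Fin.ext_iff, Fin.val_succ, Fin.val_castSucc]
    omega
  rw [descentsBefore, descentsBefore]
  simp only [hlt, or_and_right, Finset.filter_or]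
  rw [Finset.card_union_of_disjoint]
  · congr 1
    split_ifs with h
    · rw [Finset.card_eq_one]
      refine ⟨i.castSucc, ?_⟩
      ext k
      simp only [Finset.mem_filter, Finset.mem_univ, true_and, Finset.mem_singleton]
      constructor
      · exact fun hk => hk.1
      · rintro rfl
        exact ⟨rfl, hd.2 h⟩
    · rw [Finset.card_eq_zero, Finset.filter_eq_empty_iff]
      rintro k - ⟨rfl, hk⟩
      exact h (hd.1 hk)
  · rw [Finset.disjoint_filter]
    rintro k - ⟨hk, -⟩ ⟨rfl, -⟩
    exact lt_irrefl _ hk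

theorem descentsBefore_last {m : ℕ} (π : Equiv.Perm (Fin (m + 1))) :
    descentsBefore π (Fin.last m) = descentNumber π := by
  rw [descentsBefore, descentNumber]
  congr 1
  ext k
  simp only [Finset.mem_filter, Finset.mem_univ, true_and, and_iff_right_iff_imp]
  rintro ⟨j, hj, -⟩
  rw [Fin.lt_def, Fin.val_last]
  omega

/-- Subtracting the number of earlier descents turns forced strict steps into weak ones. Working in
`ℤ` keeps the subtraction from truncating. -/
theorem isCompatible_iff_monotone_sub {m R : ℕ} (π : Equiv.Perm (Fin (m + 1)))
    (f : Fin (m + 1) → Fin R) :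
    IsCompatible π f ↔ Monotone fun k => ((f k : ℕ) : ℤ) - descentsBefore π k := by
  rw [isCompatible_iff_succ, Fin.monotone_iff_le_succ]
  refine forall_congr' fun i => ?_
  rw [descentsBefore_succ]
  push_cast
  split_ifs <;> omega

theorem descentsBefore_le {m : ℕ} (π : Equiv.Perm (Fin m)) (k : Fin m) :
    descentsBefore π k ≤ descentNumber π := by
  refine Finset.card_le_card fun i => ?_
  simp only [Finset.mem_filter, Finset.mem_univ, true_and]
  exact fun h => h.2

open Classical in
theorem card_isCompatible {m : ℕ} (π : Equiv.Perm (Fin m)) (r : ℕ) :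
    (Finset.univ.filter fun f : Fin m → Fin (r + 1) => IsCompatible π f).card =
      if descentNumber π ≤ r then (m + (r - descentNumber π)).choose m else 0 := by
  rcases m with _ | m
  · have hd : descentNumber π = 0 := by simp [descentNumber]
    have : ∀ f : Fin 0 → Fin (r + 1), IsCompatible π f := fun f i => i.elim0
    simp [hd, this]
  split_ifs with hd
  · have hc : (m + 1 + (r - descentNumber π)).choose (m + 1) =
        (r - descentNumber π + 1).multichoose (m + 1) := by
      rw [Nat.multichoose_eq]
      congr 1
      omega
    rw [hc, ← card_monotone_fin]
    symm
    refine Finset.card_bij (fun h _ k => ⟨h k + descentsBefore π k, ?_⟩) ?_ ?_ ?_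
    · have := descentsBefore_le π k
      have := (h k).2
      omega
    · intro h hh
      simp only [Finset.mem_filter, Finset.mem_univ, true_and, isCompatible_iff_monotone_sub] at hh ⊢
      intro i j hij
      have := hh hij
      rw [Fin.le_def] at this
      push_cast
      omega
    · intro h _ h' _ e
      ext k
      have := congrArg Fin.val (congrFun e k)
      simpa using this
    · intro f hf
      simp only [Finset.mem_filter, Finset.mem_univ, true_and, isCompatible_iff_monotone_sub] at hf
      have h0 : ∀ k, descentsBefore π k ≤ f k := by
        intro k
        have := hf (Fin.zero_le k)
        simp only [descentsBefore_zero] at this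
        omega
      have h1 : ∀ k, (f k : ℕ) - descentsBefore π k < r - descentNumber π + 1 := by
        intro k
        have := hf (Fin.le_last k)
        simp only [descentsBefore_last] at this
        have := (f (Fin.last m)).2
        have := h0 k
        omega
      refine ⟨fun k => ⟨f k - descentsBefore π k, h1 k⟩, ?_, ?_⟩
      · simp only [Finset.mem_filter, Finset.mem_univ, true_and]
        intro i j hij
        have := hf hij
        have := h0 i
        have := h0 j
        simp only [Fin.mk_le_mk] at *
        omega
      · ext k
        have := h0 k
        simp only
        omega
  · rw [Finset.card_eq_zero, Finset.filter_eq_empty_iff]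
    intro f _ hf
    rw [isCompatible_iff_monotone_sub] at hf
    have := hf (Fin.zero_le (Fin.last m))
    simp only [descentsBefore_last, descentsBefore_zero] at this
    have := (f (Fin.last m)).2
    omega

/-! ### Compatible pairs and multisets of two-element sets -/

/-- The swap of coordinates on lexicographically ordered pairs. -/
def lexSwap {R : ℕ} (p : Fin R ×ₗ Fin R) : Fin R ×ₗ Fin R := toLex (ofLex p).swap

theorem lexSwap_lexSwap {R : ℕ} (p : Fin R ×ₗ Fin R) : lexSwap (lexSwap p) = p := rfl

/-- The word of pairs `(f k, f (π k))`. -/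
def pairWord {m R : ℕ} (π : Equiv.Perm (Fin m)) (f : Fin m → Fin R) (k : Fin m) :
    Fin R ×ₗ Fin R := toLex (f k, f (π k))

theorem lexSwap_pairWord {m R : ℕ} {π : Equiv.Perm (Fin m)} (f : Fin m → Fin R)
    (hπ : ∀ i, π (π i) = i) (k : Fin m) : lexSwap (pairWord π f k) = pairWord π f (π k) := by
  rw [pairWord, pairWord, hπ]
  rfl

theorem IsCompatible.monotone {m R : ℕ} {π : Equiv.Perm (Fin m)} {f : Fin m → Fin R}
    (h : IsCompatible π f) : Monotone f := by
  intro i j hij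
  exact Prod.Lex.monotone_fst _ _ (StrictMono.monotone h hij)

theorem IsCompatible.lt_of_eq {m R : ℕ} {π : Equiv.Perm (Fin m)} {f : Fin m → Fin R}
    (h : IsCompatible π f) {i j : Fin m} (hij : i < j) (hf : f i = f j) : π i < π j := by
  rcases Prod.Lex.toLex_lt_toLex.1 (h hij) with h' | h'
  · exact absurd hf h'.ne
  · exact h'.2

theorem IsCompatible.monotone_pairWord {m R : ℕ} {π : Equiv.Perm (Fin m)} {f : Fin m → Fin R}
    (h : IsCompatible π f) : Monotone (pairWord π f) := by
  intro i j hij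
  rcases hij.eq_or_lt with rfl | hlt
  · exact le_rfl
  rw [pairWord, pairWord, Prod.Lex.toLex_le_toLex]
  rcases (h.monotone hij).lt_or_eq with h1 | h1
  · exact Or.inl h1
  · exact Or.inr ⟨h1, h.monotone (h.lt_of_eq hlt h1).le⟩

theorem IsCompatible.apply_ne {m R : ℕ} {π : Equiv.Perm (Fin m)} {f : Fin m → Fin R}
    (h : IsCompatible π f) (hπ : ∀ i, π (π i) = i) (hfix : ∀ i, π i ≠ i) (k : Fin m) :
    f k ≠ f (π k) := by
  intro e
  rcases lt_or_gt_of_ne (hfix k) with hk | hk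
  · have := h.lt_of_eq hk e.symm
    rw [hπ] at this
    exact lt_asymm hk this
  · have := h.lt_of_eq hk e
    rw [hπ] at this
    exact lt_asymm hk this

theorem IsCompatible.eq_sort {m R : ℕ} {π : Equiv.Perm (Fin m)} {f : Fin m → Fin R}
    (h : IsCompatible π f) (hπ : ∀ i, π (π i) = i) :
    π = Tuple.sort (lexSwap ∘ pairWord π f) := by
  rw [Tuple.eq_sort_iff]
  have e : ∀ k, (lexSwap ∘ pairWord π f) (π k) = pairWord π f k := by
    intro k
    rw [Function.comp_apply, lexSwap_pairWord f hπ, hπ]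
  constructor
  · intro i j hij
    simpa only [Function.comp_apply, lexSwap_pairWord f hπ, hπ] using h.monotone_pairWord hij
  · intro i j hij hw
    rw [e, e] at hw
    exact h.lt_of_eq hij (congrArg (fun p => (ofLex p).1) hw)

theorem exists_isCompatible_of_symm {m R : ℕ} {w : Fin m → Fin R ×ₗ Fin R} (hw : Monotone w)
    (hs : Finset.univ.val.map (lexSwap ∘ w) = Finset.univ.val.map w)
    (hd : ∀ k, (ofLex (w k)).1 ≠ (ofLex (w k)).2) :
    ∃ (π : Equiv.Perm (Fin m)) (f : Fin m → Fin R), (∀ i, π (π i) = i) ∧ (∀ i, π i ≠ i) ∧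
      IsCompatible π f ∧ pairWord π f = w := by
  obtain ⟨π, hπ⟩ : ∃ π, π = Tuple.sort (lexSwap ∘ w) := ⟨_, rfl⟩
  have hπ' := Tuple.eq_sort_iff.1 hπ
  have h1 : (lexSwap ∘ w) ∘ π = w := by
    refine eq_of_monotone_of_map_eq hπ'.1 hw ?_
    rw [← hs, Fin.univ_val_map, Fin.univ_val_map, Multiset.coe_eq_coe]
    exact π.ofFn_comp_perm _
  have h2 : ∀ k, w (π k) = lexSwap (w k) := by
    intro k
    conv_rhs => rw [← h1]
    rfl
  have hst : ∀ i j, i < j → w i = w j → π i < π j := by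
    intro i j hij e
    refine hπ'.2 i j hij ?_
    have := congrFun h1
    simp only [Function.comp_apply] at this ⊢
    rw [this, this, e]
  have hai : ∀ k, π (π⁻¹ k) = k := π.apply_symm_apply
  have hinv : π⁻¹ = π := by
    refine (Tuple.eq_sort_iff.2 ?_).trans hπ.symm
    have h3 : ∀ k, (lexSwap ∘ w) (π⁻¹ k) = w k := by
      intro k
      rw [Function.comp_apply, ← h2, hai]
    constructor
    · intro i j hij
      change (lexSwap ∘ w) (π⁻¹ i) ≤ (lexSwap ∘ w) (π⁻¹ j)
      rw [h3, h3]
      exact hw hij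
    · intro i j hij e
      rw [h3, h3] at e
      by_contra hlt
      have hne : π⁻¹ j ≠ π⁻¹ i := fun h => hij.ne' (π⁻¹.injective h)
      have hlt' := lt_of_le_of_ne (not_lt.1 hlt) hne
      have := hst _ _ hlt' ?_
      · rw [hai, hai] at this
        exact lt_asymm hij this
      · have hi := h2 (π⁻¹ i)
        have hj := h2 (π⁻¹ j)
        rw [hai] at hi hj
        rw [← lexSwap_lexSwap (w (π⁻¹ j)), ← lexSwap_lexSwap (w (π⁻¹ i)), ← hi, ← hj, e]
  have hpp : ∀ i, π (π i) = i := by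
    intro i
    have := hai i
    rwa [hinv] at this
  refine ⟨π, fun k => (ofLex (w k)).1, hpp, ?_, ?_, ?_⟩
  · intro i hi
    have := h2 i
    rw [hi] at this
    exact hd i (congrArg (fun p => (ofLex p).1) this)
  · intro i j hij
    rw [Prod.Lex.toLex_lt_toLex]
    rcases Prod.Lex.toLex_le_toLex.1 (hw hij.le) with h | h
    · exact Or.inl h
    · refine Or.inr ⟨h.1, ?_⟩
      rcases h.2.lt_or_eq with h3 | h3
      · by_contra hn
        have h4 := hw (not_lt.1 hn)
        rw [h2, h2] at h4
        rcases Prod.Lex.toLex_le_toLex.1 h4 with h5 | h5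
        · exact lt_asymm h5 h3
        · exact h3.ne h5.1.symm
      · exact hst i j hij (ofLex.injective (Prod.ext h.1 h3))
  · funext k
    rw [pairWord, h2]
    rfl

/-- The increasing pairs of elements of `Fin R`. -/
abbrev IncreasingPair (R : ℕ) := {p : Fin R ×ₗ Fin R // (ofLex p).1 < (ofLex p).2}

theorem card_increasingPair (R : ℕ) : Fintype.card (IncreasingPair R) = R.choose 2 := by
  have h : Fintype.card (IncreasingPair R) =
      (Finset.univ.filter fun p : Fin R × Fin R => p.1 < p.2).card := by
    rw [Fintype.card_subtype]
    rfl
  rw [h, Finset.card_filter, Fintype.sum_prod_type_right]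
  simp only [← Finset.card_filter]
  have h2 : ∀ y : Fin R, (Finset.univ.filter fun x => x < y).card = (y : ℕ) := by
    intro y
    rw [← Fin.card_Iio y]
    congr 1
    ext
    simp
  simp only [h2]
  rw [Fin.sum_univ_eq_sum_range (fun i => i), Finset.sum_range_id, Nat.choose_two_right]

theorem eq_filter_add_map_lexSwap {R : ℕ} {s : Multiset (Fin R ×ₗ Fin R)}
    (hs : s.map lexSwap = s) (hd : ∀ p ∈ s, (ofLex p).1 ≠ (ofLex p).2) :
    s.filter (fun p => (ofLex p).1 < (ofLex p).2) +
      (s.filter (fun p => (ofLex p).1 < (ofLex p).2)).map lexSwap = s := by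
  conv_rhs => rw [← Multiset.filter_add_not (fun p => (ofLex p).1 < (ofLex p).2) s]
  congr 1
  have : s.filter (fun p => ¬ (ofLex p).1 < (ofLex p).2) =
      s.filter (fun p => (ofLex p).2 < (ofLex p).1) := by
    refine Multiset.filter_congr fun p hp => ?_
    have := hd p hp
    exact ⟨fun h => lt_of_le_of_ne (not_lt.1 h) this.symm, fun h => not_lt.2 h.le⟩
  rw [this]
  conv_rhs => rw [← hs, Multiset.filter_map]
  rfl

theorem filter_add_map_lexSwap {R : ℕ} (s : Multiset (IncreasingPair R)) :
    (s.map Subtype.val + (s.map Subtype.val).map lexSwap).filter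
      (fun p => (ofLex p).1 < (ofLex p).2) = s.map Subtype.val := by
  rw [Multiset.filter_add, Multiset.filter_eq_self.2, Multiset.filter_eq_nil.2, add_zero]
  · intro p hp
    simp only [Multiset.mem_map] at hp
    obtain ⟨q, ⟨q', _, rfl⟩, rfl⟩ := hp
    exact not_lt.2 q'.2.le
  · intro p hp
    obtain ⟨q', _, rfl⟩ := Multiset.mem_map.1 hp
    exact q'.2

open Classical in
theorem card_compatible_pairs (n R : ℕ) :
    ((fixedPointFreeInvolutions (2 * n) ×ˢ Finset.univ).filter
      fun x : Equiv.Perm (Fin (2 * n)) × (Fin (2 * n) → Fin R) => IsCompatible x.1 x.2).card =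
      (R.choose 2).multichoose n := by
  rw [← card_increasingPair, ← Sym.card_sym_eq_multichoose, ← Finset.card_univ]
  have hmem : ∀ π : Equiv.Perm (Fin (2 * n)), π ∈ fixedPointFreeInvolutions (2 * n) ↔
      (∀ i, π (π i) = i) ∧ ∀ i, π i ≠ i := by
    intro π
    simp [fixedPointFreeInvolutions]
  let S (x : Equiv.Perm (Fin (2 * n)) × (Fin (2 * n) → Fin R)) : Multiset (Fin R ×ₗ Fin R) :=
    Finset.univ.val.map (pairWord x.1 x.2)
  have hS : ∀ x : Equiv.Perm (Fin (2 * n)) × (Fin (2 * n) → Fin R),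
      x ∈ ((fixedPointFreeInvolutions (2 * n) ×ˢ Finset.univ).filter
        fun x => IsCompatible x.1 x.2) →
      ∃ s : Sym (IncreasingPair R) n,
        S x = s.1.map Subtype.val + (s.1.map Subtype.val).map lexSwap := by
    rintro ⟨π, f⟩ hx
    simp only [Finset.mem_filter, Finset.mem_product, Finset.mem_univ, and_true, hmem] at hx
    obtain ⟨⟨hπ, hfix⟩, hc⟩ := hx
    have hsymm : (S (π, f)).map lexSwap = S (π, f) := by
      simp only [S, Multiset.map_map]
      have : lexSwap ∘ pairWord π f = pairWord π f ∘ π := by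
        funext k
        exact lexSwap_pairWord f hπ k
      rw [this, Fin.univ_val_map, Fin.univ_val_map, Multiset.coe_eq_coe]
      exact π.ofFn_comp_perm _
    have hd : ∀ p ∈ S (π, f), (ofLex p).1 ≠ (ofLex p).2 := by
      intro p hp
      obtain ⟨k, _, rfl⟩ := Multiset.mem_map.1 hp
      exact hc.apply_ne hπ hfix k
    have he := eq_filter_add_map_lexSwap hsymm hd
    have hcard := congrArg Multiset.card he
    have hlift : ∀ p ∈ (S (π, f)).filter (fun p => (ofLex p).1 < (ofLex p).2),
        (ofLex p).1 < (ofLex p).2 := fun p hp => (Multiset.mem_filter.1 hp).2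
    generalize (S (π, f)).filter (fun p => (ofLex p).1 < (ofLex p).2) = A at *
    lift A to Multiset (IncreasingPair R) using hlift
    refine ⟨⟨A, ?_⟩, he.symm⟩
    simp only [S, Multiset.card_add, Multiset.card_map, Finset.card_val, Finset.card_univ,
      Fintype.card_fin] at hcard
    omega
  choose Φ hΦ using hS
  refine Finset.card_bij Φ (fun _ _ => Finset.mem_univ _) ?_ ?_
  · intro x hx y hy hxy
    have hSxy : S x = S y := by rw [hΦ x hx, hΦ y hy, hxy]
    obtain ⟨π, f⟩ := x
    obtain ⟨σ, g⟩ := y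
    simp only [Finset.mem_filter, Finset.mem_product, Finset.mem_univ, and_true, hmem] at hx hy
    have hw : pairWord π f = pairWord σ g :=
      eq_of_monotone_of_map_eq hx.2.monotone_pairWord hy.2.monotone_pairWord hSxy
    refine Prod.ext ?_ ?_
    · change π = σ
      rw [hx.2.eq_sort hx.1.1, hy.2.eq_sort hy.1.1, hw]
    · funext k
      exact congrArg (fun p => (ofLex p).1) (congrFun hw k)
  · intro s _
    obtain ⟨w, hw, hws⟩ := exists_monotone_map_eq (m := 2 * n)
      (s.1.map Subtype.val + (s.1.map Subtype.val).map lexSwap) (by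
        rw [Multiset.card_add, Multiset.card_map, Multiset.card_map, Multiset.card_map, s.2]
        ring)
    obtain ⟨π, f, hπ, hfix, hc, rfl⟩ := exists_isCompatible_of_symm hw (by
        rw [← Multiset.map_map, hws, Multiset.map_add, Multiset.map_map lexSwap lexSwap,
          show (lexSwap ∘ lexSwap : Fin R ×ₗ Fin R → _) = id from rfl, Multiset.map_id, add_comm])
      (by
        intro k
        have hk : w k ∈ Finset.univ.val.map w := Multiset.mem_map_of_mem _ (Finset.mem_univ k)
        rw [hws, Multiset.mem_add, Multiset.mem_map, Multiset.mem_map] at hk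
        rcases hk with ⟨p, _, hp⟩ | ⟨q, hq, hp⟩
        · rw [← hp]
          exact p.2.ne
        · obtain ⟨p, _, rfl⟩ := Multiset.mem_map.1 hq
          rw [← hp]
          exact p.2.ne')
    have hx : (π, f) ∈ (fixedPointFreeInvolutions (2 * n) ×ˢ Finset.univ).filter
        fun x : Equiv.Perm (Fin (2 * n)) × (Fin (2 * n) → Fin R) => IsCompatible x.1 x.2 := by
      simp only [Finset.mem_filter, Finset.mem_product, Finset.mem_univ, and_true, hmem]
      exact ⟨⟨hπ, hfix⟩, hc⟩
    refine ⟨(π, f), hx, ?_⟩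
    have h1 := hΦ (π, f) hx
    have h2 : S (π, f) = s.1.map Subtype.val + (s.1.map Subtype.val).map lexSwap := hws
    have h3 := congrArg (Multiset.filter fun p => (ofLex p).1 < (ofLex p).2) (h1.symm.trans h2)
    rw [filter_add_map_lexSwap, filter_add_map_lexSwap] at h3
    exact Subtype.ext (Multiset.map_injective Subtype.val_injective h3)

theorem jPoly_eq_mul_pairMultisetSeries (n : ℕ) : (jPoly (2 * n) : PowerSeries ℚ) =
    (1 - PowerSeries.X) ^ (2 * n + 1) * pairMultisetSeries n := by
  classical
  have h : pairMultisetSeries n =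
      jPoly (2 * n) * PowerSeries.mk fun r => ((2 * n + r).choose (2 * n) : ℚ) := by
    ext r
    rw [pairMultisetSeries, PowerSeries.coeff_mk, ← card_compatible_pairs n (r + 1),
      Finset.card_filter, Finset.sum_product, jPoly]
    have hc : ((∑ π ∈ fixedPointFreeInvolutions (2 * n), X ^ descentNumber π : ℚ[X]) :
        PowerSeries ℚ) = ∑ π ∈ fixedPointFreeInvolutions (2 * n),
          PowerSeries.X ^ descentNumber π := by
      rw [← Polynomial.coeToPowerSeries.ringHom_apply, map_sum]
      simp
    rw [hc, Finset.sum_mul, map_sum, Nat.cast_sum]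
    refine Finset.sum_congr rfl fun π _ => ?_
    rw [PowerSeries.coeff_X_pow_mul', ← Finset.card_filter, card_isCompatible]
    split_ifs
    · rw [PowerSeries.coeff_mk]
    · simp
  rw [h, mul_left_comm, mul_comm (_ ^ _), PowerSeries.mk_add_choose_mul_one_sub_pow_eq_one, mul_one]

theorem mainTheorem7 :
    (∀ n : ℕ, 1 ≤ n →
      jPoly (2 * n) = ∑ k ∈ Finset.Icc 1 n, C (bCoeff n k) * X ^ k * (1 + X) ^ (2 * n - 2 * k)) ∧
    (∀ n : ℕ, 1 ≤ n → ∀ c : ℕ → ℚ,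
      jPoly (2 * n) = ∑ k ∈ Finset.Icc 1 n, C (c k) * X ^ k * (1 + X) ^ (2 * n - 2 * k) →
      ∀ k ∈ Finset.Icc 1 n, c k = bCoeff n k) ∧
    (∀ n : ℕ, 2 ≤ n → ∀ k : ℤ, 1 ≤ k →
      2 * (n : ℚ) * bCoeff n k =
        ((k : ℚ) * (k + 1) + 2 * n - 2) * bCoeff (n - 1) k +
        (2 + 2 * ((k : ℚ) - 1) * (4 * n - 4 * k - 3)) * bCoeff (n - 1) (k - 1) +
        8 * ((n : ℚ) - k + 1) * (2 * n - 2 * k + 1) * bCoeff (n - 1) (k - 2)) := by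
  refine ⟨fun n hn => ?_, fun n hn c h => eq_bCoeff_of_jPoly_eq hn h, fun n hn k hk => ?_⟩
  · obtain ⟨m, rfl⟩ := Nat.exists_eq_add_of_le' hn
    exact jPoly_eq_expansion jPoly_eq_mul_pairMultisetSeries m
  · obtain ⟨m, rfl⟩ := Nat.exists_eq_add_of_le' hn
    have h := bCoeff_recurrence jPoly_eq_mul_pairMultisetSeries m k hk
    rw [recurrenceSum] at h
    rw [show m + 2 - 1 = m + 1 by omega]
    push_cast
    linear_combination h
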